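/- Let $n \ge 1$, $a, b > 0$ and $\eta \in \mathbb{R}$. Let $f : \mathbb{R}^n \times [0,\infty) \to \mathbb{R}$ be a positive classical solution of the Newell–Whitehead equation $$f_t = \Delta f + a f - b f^3,$$ that is, for $t > 0$ the function $f$ is $C^2$ in $x$, differentiable in $t$, and satisfies the equation pointwise. Suppose that $f$ is a traveling wave: there is a function $v : \mathbb{R}^n \to \mathbb{R}$ with $$f(x_1,\dots,x_n,t) = v(x_1,\dots,x_{n-1},x_n+\eta t)\qquad\text{for all } x \in \mathbb{R}^n,\ t \ge 0.$$ Then $v$ is differentiable and $$|\nabla v(z)| \le |\eta|\, v(z)\qquad\text{for all } z \in \mathbb{R}^n .$$ In particular, $|\nabla v| \le \eta v$ if the wave speed $\eta$ is nonnegative. -/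

import Mathlib

/-- `f` is a classical solution on `ℝⁿ × [0, ∞)` of the Newell-Whitehead equation
`f_t = Δ f + a f - b f ^ 3`: at positive times it is `C²` in the space variable, differentiable in
the time variable, and satisfies the equation pointwise, where `Δ` is the Laplacian in the space
variable. The values of `f` at negative times play no role. -/
structure IsNewellWhiteheadSolution {n : ℕ} (a b : ℝ)
    (f : EuclideanSpace ℝ (Fin n) → ℝ → ℝ) : Prop where
  contDiff_space : ∀ t : ℝ, 0 < t → ContDiff ℝ 2 (fun x => f x t)
  differentiableAt_time : ∀ (x : EuclideanSpace ℝ (Fin n)) (t : ℝ), 0 < t →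
    DifferentiableAt ℝ (fun s => f x s) t
  equation : ∀ (x : EuclideanSpace ℝ (Fin n)) (t : ℝ), 0 < t →
    deriv (fun s => f x s) t
      = Laplacian.laplacian (fun y => f y t) x + a * f x t - b * f x t ^ 3

/-- `f (x, t) = v (x₁, …, x_{n-1}, x_n + η t)` for all `x ∈ ℝⁿ` and `t ≥ 0`, where `n = d + 1 ≥ 1`:
the function `f` is a traveling wave with profile `v` and wave speed `η`, in the direction of the
last coordinate. -/
def IsTravelingWave {d : ℕ} (f : EuclideanSpace ℝ (Fin (d + 1)) → ℝ → ℝ)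
    (v : EuclideanSpace ℝ (Fin (d + 1)) → ℝ) (η : ℝ) : Prop :=
  ∀ (x : EuclideanSpace ℝ (Fin (d + 1))) (t : ℝ), 0 ≤ t →
    f x t = v (x + EuclideanSpace.single (Fin.last d) (η * t))

/-! The profile solves `Δv = η ∂ₗv + b v³ - a v`. With `w = log v` and `P = |∇w|² - η ∂ₗw`, the
identity `Δw + P = b v² - a =: S` holds, and `P ≤ 0` says `|∇v|² ≤ η v ∂ₗv ≤ |η| v |∇v|`, which is
the claim.

To exclude `P(z) > 0`, the maximum principle is applied to `χ P`, with `χ` a cutoff on the ball of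
radius `R` about `z`. Bochner's formula for `ΔP`, with `Δw = S - P` and `|D²w|² ≥ (Δw)² / n`, gives
`IsLocalMax.waveExcess_inequality`. The reaction enters through `2⟨∇w, ∇S⟩ - η ∂ₗS = 2 b v² (P +
|∇w|²)`, which is nonnegative where `P > 0`. What remains is quadratic in `P` against cutoff errors
of lower order in `R`, impossible for a suitable `R` (`waveExcess_log_nonpos`).

Bochner's formula needs three derivatives of `w`, while `v` is only `C²`. The inequality is
therefore proved for mollifications of `v`; only first derivatives of `v` and of `g = b v³ - a v`
appear in it, so it passes to the limit (`exists_waveExcess_inequality`). -/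

open Filter Topology MeasureTheory

/-! ### Calculus of partial derivatives and conditions at a local maximum. -/

section PartialDerivatives

variable {ι : Type*} [Fintype ι] [DecidableEq ι]

/-- The partial derivative of `f` in the direction of the `i`-th coordinate. -/
noncomputable def partialDeriv (i : ι) (f : EuclideanSpace ℝ ι → ℝ) : EuclideanSpace ℝ ι → ℝ :=
  fun x => fderiv ℝ f x (EuclideanSpace.single i 1)

variable {f g : EuclideanSpace ℝ ι → ℝ} {x : EuclideanSpace ℝ ι} {i j : ι}

theorem ContDiff.partialDeriv {m n : WithTop ℕ∞} (hf : ContDiff ℝ n f) (hmn : m + 1 ≤ n) (i : ι) :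
    ContDiff ℝ m (partialDeriv i f) :=
  (hf.fderiv_right hmn).clm_apply contDiff_const

theorem partialDeriv_const (c : ℝ) : partialDeriv i (fun _ => c) x = 0 := by
  simp [partialDeriv]

theorem partialDeriv_add (hf : DifferentiableAt ℝ f x) (hg : DifferentiableAt ℝ g x) :
    partialDeriv i (fun y => f y + g y) x = partialDeriv i f x + partialDeriv i g x := by
  simp [partialDeriv, fderiv_fun_add hf hg]

theorem partialDeriv_sub (hf : DifferentiableAt ℝ f x) (hg : DifferentiableAt ℝ g x) :
    partialDeriv i (fun y => f y - g y) x = partialDeriv i f x - partialDeriv i g x := by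
  simp [partialDeriv, fderiv_fun_sub hf hg]

theorem partialDeriv_mul (hf : DifferentiableAt ℝ f x) (hg : DifferentiableAt ℝ g x) :
    partialDeriv i (fun y => f y * g y) x
      = f x * partialDeriv i g x + g x * partialDeriv i f x := by
  simp [partialDeriv, fderiv_fun_mul hf hg]

theorem partialDeriv_const_mul (c : ℝ) (hf : DifferentiableAt ℝ f x) :
    partialDeriv i (fun y => c * f y) x = c * partialDeriv i f x := by
  rw [partialDeriv_mul (differentiableAt_const c) hf, partialDeriv_const, mul_zero, add_zero]

theorem partialDeriv_pow (n : ℕ) (hf : DifferentiableAt ℝ f x) :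
    partialDeriv i (fun y => f y ^ n) x = n * f x ^ (n - 1) * partialDeriv i f x := by
  simp [partialDeriv, fderiv_fun_pow n hf]

theorem partialDeriv_sum {κ : Type*} (s : Finset κ) {F : κ → EuclideanSpace ℝ ι → ℝ}
    (hF : ∀ k ∈ s, DifferentiableAt ℝ (F k) x) :
    partialDeriv i (fun y => ∑ k ∈ s, F k y) x = ∑ k ∈ s, partialDeriv i (F k) x := by
  simp [partialDeriv, fderiv_fun_sum hF]

theorem partialDeriv_log (hf : DifferentiableAt ℝ f x) (h0 : f x ≠ 0) :
    partialDeriv i (fun y => Real.log (f y)) x = partialDeriv i f x / f x := by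
  simp [partialDeriv, fderiv.log hf h0, div_eq_inv_mul]

theorem partialDeriv_div (hf : DifferentiableAt ℝ f x) (hg : DifferentiableAt ℝ g x)
    (h0 : g x ≠ 0) :
    partialDeriv i (fun y => f y / g y) x
      = partialDeriv i f x / g x - f x * partialDeriv i g x / g x ^ 2 := by
  have hq : DifferentiableAt ℝ (fun y => f y / g y) x := by
    simp only [div_eq_mul_inv]
    exact hf.mul (hg.inv h0)
  have hev : f =ᶠ[𝓝 x] fun y => f y / g y * g y := by
    filter_upwards [hg.continuousAt.eventually_ne h0] with y hy
    rw [div_mul_cancel₀ _ hy]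
  have h : partialDeriv i f x = partialDeriv i (fun y => f y / g y * g y) x := by
    simp only [partialDeriv, hev.fderiv_eq]
  rw [partialDeriv_mul hq hg] at h
  rw [h]
  field_simp
  ring

theorem partialDeriv_comm (hf : ContDiff ℝ 2 f) (i j : ι) :
    partialDeriv i (partialDeriv j f) = partialDeriv j (partialDeriv i f) := by
  have hd : ∀ x, DifferentiableAt ℝ (fderiv ℝ f) x := fun x =>
    ((hf.fderiv_right (m := 1) (by norm_num)).differentiable (by norm_num)) x
  have key : ∀ i j x, partialDeriv i (partialDeriv j f) x
      = fderiv ℝ (fderiv ℝ f) x (EuclideanSpace.single i 1) (EuclideanSpace.single j 1) := by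
    intro i j x
    unfold partialDeriv
    rw [fderiv_clm_apply (hd x) (differentiableAt_const _)]
    simp
  ext x
  rw [key, key]
  exact (hf.contDiffAt.isSymmSndFDerivAt (by simp)) _ _

theorem laplacian_eq_sum_partialDeriv (hf : ContDiff ℝ 2 f) (x : EuclideanSpace ℝ ι) :
    Laplacian.laplacian f x = ∑ i, partialDeriv i (partialDeriv i f) x := by
  rw [InnerProductSpace.laplacian_eq_iteratedFDeriv_orthonormalBasis f
    (EuclideanSpace.basisFun ι ℝ)]
  refine Finset.sum_congr rfl fun i _ => ?_
  rw [iteratedFDeriv_two_apply]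
  have hd : DifferentiableAt ℝ (fderiv ℝ f) x :=
    ((hf.fderiv_right (m := 1) (by norm_num)).differentiable (by norm_num)) x
  unfold partialDeriv
  rw [fderiv_clm_apply hd (differentiableAt_const _)]
  simp

theorem norm_gradient_sq (f : EuclideanSpace ℝ ι → ℝ) (x : EuclideanSpace ℝ ι) :
    ‖gradient f x‖ ^ 2 = ∑ i, partialDeriv i f x ^ 2 := by
  rw [EuclideanSpace.norm_sq_eq]
  refine Finset.sum_congr rfl fun i _ => ?_
  have h : inner ℝ (gradient f x) (EuclideanSpace.single i 1)
      = fderiv ℝ f x (EuclideanSpace.single i 1) := by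
    simp [gradient]
  rw [EuclideanSpace.inner_single_right] at h
  simp only [one_mul, conj_trivial] at h
  rw [h, Real.norm_eq_abs, sq_abs, partialDeriv]

theorem IsLocalMax.partialDeriv_eq_zero (h : IsLocalMax f x) (i : ι) :
    _root_.partialDeriv i f x = 0 := by
  simp [_root_.partialDeriv, h.fderiv_eq_zero]

theorem IsLocalMax.deriv_deriv_nonpos {u : ℝ → ℝ} {t : ℝ} (h : IsLocalMax u t)
    (hc : ContinuousAt u t) : deriv (deriv u) t ≤ 0 := by
  by_contra! hpos
  -- A local maximum that is also a local minimum is locally constant, so its second derivative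
  -- vanishes.
  have hmin := isLocalMin_of_deriv_deriv_pos hpos h.deriv_eq_zero hc
  have hconst : u =ᶠ[𝓝 t] fun _ => u t := by
    filter_upwards [h, hmin] with s hs hs' using le_antisymm hs hs'
  have h1 : deriv u =ᶠ[𝓝 t] deriv fun _ => u t := hconst.deriv
  rw [h1.deriv_eq] at hpos
  simp at hpos

theorem hasDerivAt_comp_line (hf : Differentiable ℝ f) (x : EuclideanSpace ℝ ι) (i : ι) (s : ℝ) :
    HasDerivAt (fun t : ℝ => f (x + t • EuclideanSpace.single i (1 : ℝ)))
      (partialDeriv i f (x + s • EuclideanSpace.single i (1 : ℝ))) s := by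
  have hl : HasDerivAt (fun t : ℝ => x + t • EuclideanSpace.single i (1 : ℝ))
      (EuclideanSpace.single i (1 : ℝ)) s := by
    simpa using ((hasDerivAt_id s).smul_const (EuclideanSpace.single i (1 : ℝ))).const_add x
  exact (hf _).hasFDerivAt.comp_hasDerivAt s hl

theorem IsLocalMax.partialDeriv_partialDeriv_nonpos (hf : ContDiff ℝ 2 f) (h : IsLocalMax f x)
    (i : ι) : _root_.partialDeriv i (_root_.partialDeriv i f) x ≤ 0 := by
  have hf1 : ContDiff ℝ 1 (_root_.partialDeriv i f) := hf.partialDeriv (by norm_num) i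
  have h1 : deriv (fun t : ℝ => f (x + t • EuclideanSpace.single i (1 : ℝ)))
      = fun t => _root_.partialDeriv i f (x + t • EuclideanSpace.single i (1 : ℝ)) :=
    funext fun s => (hasDerivAt_comp_line (hf.differentiable (by norm_num)) x i s).deriv
  have h2 := (hasDerivAt_comp_line (hf1.differentiable (by norm_num)) x i 0).deriv
  have hcont : Continuous fun t : ℝ => x + t • EuclideanSpace.single i (1 : ℝ) := by fun_prop
  have hmax : IsLocalMax (fun t : ℝ => f (x + t • EuclideanSpace.single i (1 : ℝ))) 0 := by
    have hx : x = x + (0 : ℝ) • EuclideanSpace.single i (1 : ℝ) := by simp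
    have h' : IsLocalMax f (x + (0 : ℝ) • EuclideanSpace.single i (1 : ℝ)) := hx ▸ h
    exact h'.comp_continuous (g := fun t : ℝ => x + t • EuclideanSpace.single i (1 : ℝ))
      hcont.continuousAt
  have := hmax.deriv_deriv_nonpos (hf.continuous.comp hcont).continuousAt
  rw [h1, h2] at this
  simpa using this

end PartialDerivatives

/-! ### Bochner's formula and the localized maximum principle. -/

section Bochner

variable {ι : Type*} [Fintype ι] [DecidableEq ι]

/-- The quantity `|∇ w|² - η ∂ₗ w`. -/
noncomputable def waveExcess (η : ℝ) (l : ι) (w : EuclideanSpace ℝ ι → ℝ) :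
    EuclideanSpace ℝ ι → ℝ :=
  fun x => ∑ j, partialDeriv j w x ^ 2 - η * partialDeriv l w x

/-- The Laplacian as the sum of the pure second partial derivatives. -/
noncomputable def sumSecondDeriv (w : EuclideanSpace ℝ ι → ℝ) : EuclideanSpace ℝ ι → ℝ :=
  fun x => ∑ i, partialDeriv i (partialDeriv i w) x

variable {w χ : EuclideanSpace ℝ ι → ℝ} {x : EuclideanSpace ℝ ι} (η : ℝ) (l : ι)

theorem ContDiff.waveExcess {m n : WithTop ℕ∞} (hw : ContDiff ℝ n w) (hmn : m + 1 ≤ n) :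
    ContDiff ℝ m (waveExcess η l w) :=
  (ContDiff.sum fun j _ => (hw.partialDeriv hmn j).pow 2).sub
    (contDiff_const.mul (hw.partialDeriv hmn l))

theorem ContDiff.sumSecondDeriv {m n : WithTop ℕ∞} (hw : ContDiff ℝ n w) (hmn : m + 1 + 1 ≤ n) :
    ContDiff ℝ m (sumSecondDeriv w) :=
  ContDiff.sum fun j _ => (hw.partialDeriv hmn j).partialDeriv le_rfl j

theorem partialDeriv_waveExcess (hw : ContDiff ℝ 2 w) (i : ι) :
    partialDeriv i (waveExcess η l w) = fun x =>
      ∑ j, 2 * (partialDeriv j w x * partialDeriv i (partialDeriv j w) x)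
        - η * partialDeriv i (partialDeriv l w) x := by
  have hd : ∀ j, Differentiable ℝ (partialDeriv j w) := fun j =>
    (hw.partialDeriv (m := 1) (by norm_num) j).differentiable (by norm_num)
  ext x
  unfold waveExcess
  rw [partialDeriv_sub (by fun_prop) (by fun_prop), partialDeriv_const_mul _ (hd l x),
    partialDeriv_sum _ (fun j _ => by fun_prop)]
  congr 1
  refine Finset.sum_congr rfl fun j _ => ?_
  rw [partialDeriv_pow _ (hd j x)]
  norm_num
  ring

/-- Bochner's formula for `|∇ w|² - η ∂ₗ w`. -/
theorem sumSecondDeriv_waveExcess (hw : ContDiff ℝ 3 w) (x : EuclideanSpace ℝ ι) :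
    sumSecondDeriv (waveExcess η l w) x
      = 2 * ∑ i, ∑ j, partialDeriv i (partialDeriv j w) x ^ 2
        + 2 * ∑ j, partialDeriv j w x * partialDeriv j (sumSecondDeriv w) x
        - η * partialDeriv l (sumSecondDeriv w) x := by
  have hw2 : ContDiff ℝ 2 w := hw.of_le (by norm_num)
  have hc1 : ∀ j, ContDiff ℝ 2 (partialDeriv j w) := fun j => hw.partialDeriv (by norm_num) j
  have hd1 : ∀ j, Differentiable ℝ (partialDeriv j w) := fun j =>
    (hc1 j).differentiable (by norm_num)
  have hd2 : ∀ i j, Differentiable ℝ (partialDeriv i (partialDeriv j w)) := fun i j =>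
    ((hc1 j).partialDeriv (m := 1) (by norm_num) i).differentiable (by norm_num)
  have hsym : ∀ i j, partialDeriv i (partialDeriv i (partialDeriv j w))
      = partialDeriv j (partialDeriv i (partialDeriv i w)) := by
    intro i j
    rw [partialDeriv_comm hw2 i j, partialDeriv_comm (hc1 i) i j]
  have hlap : ∀ j, partialDeriv j (sumSecondDeriv w) x
      = ∑ i, partialDeriv i (partialDeriv i (partialDeriv j w)) x := by
    intro j
    unfold sumSecondDeriv
    rw [partialDeriv_sum _ (fun i _ => hd2 i i x)]
    exact Finset.sum_congr rfl fun i _ => by rw [hsym]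
  have hsecond : ∀ i, partialDeriv i (partialDeriv i (waveExcess η l w)) x
      = ∑ j, (2 * partialDeriv i (partialDeriv j w) x ^ 2
          + 2 * (partialDeriv j w x * partialDeriv i (partialDeriv i (partialDeriv j w)) x))
        - η * partialDeriv i (partialDeriv i (partialDeriv l w)) x := by
    intro i
    rw [partialDeriv_waveExcess η l hw2,
      partialDeriv_sub (by fun_prop) (by fun_prop), partialDeriv_const_mul _ (hd2 i l x),
      partialDeriv_sum _ (fun j _ => by fun_prop)]
    congr 1
    refine Finset.sum_congr rfl fun j _ => ?_
    rw [partialDeriv_const_mul _ (by fun_prop), partialDeriv_mul (hd1 j x) (hd2 i j x)]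
    ring
  simp_rw [hlap]
  unfold sumSecondDeriv
  simp_rw [hsecond, Finset.sum_sub_distrib, Finset.sum_add_distrib, Finset.mul_sum]
  congr 2
  exact Finset.sum_comm

/-- Cauchy–Schwarz on the trace of the Hessian, after which the off-diagonal squares are added. -/
theorem sumSecondDeriv_sq_le (w : EuclideanSpace ℝ ι → ℝ) (x : EuclideanSpace ℝ ι) :
    sumSecondDeriv w x ^ 2
      ≤ Fintype.card ι * ∑ i, ∑ j, partialDeriv i (partialDeriv j w) x ^ 2 := by
  refine (sq_sum_le_card_mul_sum_sq (s := Finset.univ)).trans ?_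
  refine mul_le_mul_of_nonneg_left (Finset.sum_le_sum fun i _ => ?_) (by positivity)
  exact Finset.single_le_sum (f := fun j => partialDeriv i (partialDeriv j w) x ^ 2)
    (fun j _ => sq_nonneg _) (Finset.mem_univ i)

/-- The maximum principle for `χ (|∇ w|² - η ∂ₗ w)`, in terms of `S = Δ w + |∇ w|² - η ∂ₗ w`. -/
theorem IsLocalMax.waveExcess_inequality (hw : ContDiff ℝ 3 w) (hχ : ContDiff ℝ 2 χ)
    (hχ0 : 0 ≤ χ x) (hmax : IsLocalMax (fun y => χ y * waveExcess η l w y) x)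
    {S : EuclideanSpace ℝ ι → ℝ} (hS : ∀ y, S y = sumSecondDeriv w y + waveExcess η l w y) :
    2 * χ x ^ 2 * (S x - waveExcess η l w x) ^ 2
      + Fintype.card ι * (2 * χ x ^ 2 * ∑ j, partialDeriv j w x * partialDeriv j S x
        - η * χ x ^ 2 * partialDeriv l S x
        + 2 * (χ x * waveExcess η l w x) * ∑ j, partialDeriv j w x * partialDeriv j χ x
        - η * (χ x * waveExcess η l w x) * partialDeriv l χ x
        - 2 * waveExcess η l w x * ∑ j, partialDeriv j χ x ^ 2
        + χ x * waveExcess η l w x * sumSecondDeriv χ x) ≤ 0 := by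
  set P := waveExcess η l w with hP
  have hPc : ContDiff ℝ 2 P := hw.waveExcess η l (by norm_num)
  have hLd : Differentiable ℝ (sumSecondDeriv w) :=
    (hw.sumSecondDeriv (m := 1) (by norm_num)).differentiable (by norm_num)
  have hPd : Differentiable ℝ P := hPc.differentiable (by norm_num)
  have hχd : Differentiable ℝ χ := hχ.differentiable (by norm_num)
  have hPd2 : ∀ i, Differentiable ℝ (partialDeriv i P) := fun i =>
    (hPc.partialDeriv (m := 1) (by norm_num) i).differentiable (by norm_num)
  have hχd2 : ∀ i, Differentiable ℝ (partialDeriv i χ) := fun i =>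
    (hχ.partialDeriv (m := 1) (by norm_num) i).differentiable (by norm_num)
  have hSfun : S = fun y => sumSecondDeriv w y + P y := funext hS
  have hDS : ∀ j, partialDeriv j (sumSecondDeriv w) x = partialDeriv j S x - partialDeriv j P x := by
    intro j
    rw [hSfun, partialDeriv_add (hLd x) (hPd x)]
    ring
  have hfirst : ∀ i, χ x * partialDeriv i P x = -(P x * partialDeriv i χ x) := by
    intro i
    have h := hmax.partialDeriv_eq_zero i
    rw [partialDeriv_mul (hχd x) (hPd x)] at h
    linarith
  have hprod : ∀ i, partialDeriv i (fun y => χ y * P y)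
      = fun y => χ y * partialDeriv i P y + P y * partialDeriv i χ y := fun i =>
    funext fun y => partialDeriv_mul (hχd y) (hPd y)
  have hsecond : ∀ i, χ x ^ 2 * partialDeriv i (partialDeriv i P) x
      - 2 * P x * partialDeriv i χ x ^ 2
      + χ x * P x * partialDeriv i (partialDeriv i χ) x ≤ 0 := by
    intro i
    have h := hmax.partialDeriv_partialDeriv_nonpos (hχ.mul hPc) i
    rw [hprod, partialDeriv_add (by fun_prop) (by fun_prop), partialDeriv_mul (hχd x) (hPd2 i x),
      partialDeriv_mul (hPd x) (hχd2 i x)] at h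
    -- The extra factor `χ` turns every `∂ᵢP` into `χ ∂ᵢP = -P ∂ᵢχ`, so first derivatives of `P`
    -- disappear without division by `χ`.
    have h' := mul_nonpos_of_nonneg_of_nonpos hχ0 h
    have e : χ x * (χ x * partialDeriv i (partialDeriv i P) x
        + partialDeriv i P x * partialDeriv i χ x
        + (P x * partialDeriv i (partialDeriv i χ) x + partialDeriv i χ x * partialDeriv i P x))
        = χ x ^ 2 * partialDeriv i (partialDeriv i P) x
          + 2 * partialDeriv i χ x * (χ x * partialDeriv i P x)
          + χ x * P x * partialDeriv i (partialDeriv i χ) x := by ring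
    rw [e, hfirst] at h'
    linarith
  have hsum : χ x ^ 2 * sumSecondDeriv P x - 2 * P x * ∑ j, partialDeriv j χ x ^ 2
      + χ x * P x * sumSecondDeriv χ x ≤ 0 := by
    have h := Finset.sum_nonpos fun i (_ : i ∈ Finset.univ) => hsecond i
    simpa only [sumSecondDeriv, Finset.sum_add_distrib, Finset.sum_sub_distrib,
      ← Finset.mul_sum] using h
  have hb := sumSecondDeriv_waveExcess η l hw x
  rw [← hP] at hb
  simp_rw [hDS] at hb
  have hA : χ x ^ 2 * ∑ j, partialDeriv j w x * (partialDeriv j S x - partialDeriv j P x)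
      = χ x ^ 2 * ∑ j, partialDeriv j w x * partialDeriv j S x
        + χ x * P x * ∑ j, partialDeriv j w x * partialDeriv j χ x := by
    simp_rw [Finset.mul_sum, ← Finset.sum_add_distrib]
    refine Finset.sum_congr rfl fun j _ => ?_
    linear_combination (-χ x * partialDeriv j w x) * hfirst j
  have hB : χ x ^ 2 * (partialDeriv l S x - partialDeriv l P x)
      = χ x ^ 2 * partialDeriv l S x + χ x * P x * partialDeriv l χ x := by
    linear_combination (-χ x) * hfirst l
  have hcs := mul_le_mul_of_nonneg_left (sumSecondDeriv_sq_le w x)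
    (by positivity : 0 ≤ 2 * χ x ^ 2)
  have hSP : S x - P x = sumSecondDeriv w x := by rw [hS]; ring
  rw [hSP]
  have hN := mul_nonpos_of_nonneg_of_nonpos (Nat.cast_nonneg (α := ℝ) (Fintype.card ι)) hsum
  refine le_trans ?_ hN
  rw [hb]
  have e : χ x ^ 2 * (2 * ∑ i, ∑ j, partialDeriv i (partialDeriv j w) x ^ 2
        + 2 * ∑ j, partialDeriv j w x * (partialDeriv j S x - partialDeriv j P x)
        - η * (partialDeriv l S x - partialDeriv l P x))
      = 2 * χ x ^ 2 * ∑ i, ∑ j, partialDeriv i (partialDeriv j w) x ^ 2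
        + 2 * (χ x ^ 2 * ∑ j, partialDeriv j w x * partialDeriv j S x
          + χ x * P x * ∑ j, partialDeriv j w x * partialDeriv j χ x)
        - η * (χ x ^ 2 * partialDeriv l S x + χ x * P x * partialDeriv l χ x) := by
    rw [← hA, ← hB]; ring
  rw [e]
  linarith

end Bochner

/-! ### Mollification, and the maximum principle for `C²` functions. -/

section Mollification

open scoped Convolution
open ContinuousLinearMap (lsmul)

variable {ι : Type*} [Fintype ι]

/-- Keeps the logarithm of the mollified profile smooth: the integrand is nonnegative and its
support is a ball of positive measure. -/
theorem convolution_pos {φ : ContDiffBump (0 : EuclideanSpace ℝ ι)}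
    {g : EuclideanSpace ℝ ι → ℝ} (hg : Continuous g) (hpos : ∀ x, 0 < g x)
    (x : EuclideanSpace ℝ ι) : 0 < (φ.normed volume ⋆[lsmul ℝ ℝ] g) x := by
  simp only [convolution, ContinuousLinearMap.lsmul_apply, smul_eq_mul]
  have hc : Continuous (φ.normed (volume : Measure (EuclideanSpace ℝ ι))) :=
    φ.continuous_normed
  have hi : Integrable fun t => φ.normed volume t * g (x - t) :=
    (hc.mul (by fun_prop)).integrable_of_hasCompactSupport φ.hasCompactSupport_normed.mul_right
  rw [integral_pos_iff_support_of_nonneg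
    (fun t => mul_nonneg (φ.nonneg_normed t) (hpos _).le) hi]
  have hs : Function.support (fun t => φ.normed volume t * g (x - t))
      = Metric.ball (0 : EuclideanSpace ℝ ι) φ.rOut := by
    rw [← φ.support_normed_eq (μ := volume)]
    ext t
    simp [(hpos (x - t)).ne']
  rw [hs]
  exact Metric.measure_ball_pos _ _ φ.rOut_pos

variable [DecidableEq ι]

/-- Putting the derivative on `g` instead of the kernel makes derivatives of mollifications converge
to those of `g`, and lets mollification respect the equation. -/
theorem partialDeriv_convolution {ρ g : EuclideanSpace ℝ ι → ℝ} (hρs : HasCompactSupport ρ)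
    (hρ : ContDiff ℝ 1 ρ) (hg : ContDiff ℝ 1 g) (i : ι) :
    partialDeriv i (ρ ⋆[lsmul ℝ ℝ] g) = ρ ⋆[lsmul ℝ ℝ] (partialDeriv i g) := by
  ext x
  have hsmooth : Differentiable ℝ (ρ ⋆[lsmul ℝ ℝ] g) :=
    ((hρs.contDiff_convolution_left (n := 1) (lsmul ℝ ℝ) hρ
      hg.continuous.locallyIntegrable)).differentiable (by norm_num)
  have hg' : Continuous (partialDeriv i g) :=
    (hg.partialDeriv (m := 0) (by norm_num) i).continuous
  have hρc := hρ.continuous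
  have hgc := hg.continuous
  set e : EuclideanSpace ℝ ι := EuclideanSpace.single i 1 with he
  -- Domination is needed only for `|s| ≤ 1` and on the compact support of `ρ`, where continuity
  -- supplies a bound.
  obtain ⟨C, hC⟩ : ∃ C, ∀ q ∈ Metric.closedBall (0 : ℝ) 1 ×ˢ tsupport ρ,
      ‖partialDeriv i g ((x - q.2) + q.1 • e)‖ ≤ C :=
    ((isCompact_closedBall (0 : ℝ) 1).prod hρs).exists_bound_of_continuousOn
      (f := fun q : ℝ × EuclideanSpace ℝ ι => partialDeriv i g ((x - q.2) + q.1 • e))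
      (by fun_prop)
  have hint : ∀ {h : EuclideanSpace ℝ ι → ℝ}, Continuous h →
      Integrable fun t => ρ t * h t := fun hh =>
    (hρc.mul hh).integrable_of_hasCompactSupport hρs.mul_right
  have key := (hasDerivAt_integral_of_dominated_loc_of_deriv_le (μ := volume)
    (F := fun (s : ℝ) t => ρ t * g ((x - t) + s • e))
    (F' := fun (s : ℝ) t => ρ t * partialDeriv i g ((x - t) + s • e))
    (bound := fun t => ‖ρ t‖ * C) (x₀ := (0 : ℝ)) (s := Metric.closedBall 0 1)
    (Metric.closedBall_mem_nhds _ one_pos)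
    (Eventually.of_forall fun s => Continuous.aestronglyMeasurable (by fun_prop))
    (hint (by fun_prop)) (Continuous.aestronglyMeasurable (by fun_prop))
    (Eventually.of_forall fun t s hs => by
      rw [norm_mul]
      by_cases ht : t ∈ tsupport ρ
      · exact mul_le_mul_of_nonneg_left (hC (s, t) ⟨hs, ht⟩) (norm_nonneg _)
      · simp [image_eq_zero_of_notMem_tsupport ht])
    ((hint continuous_const).norm.congr (Eventually.of_forall fun t => by
      change ‖ρ t * 1‖ = ‖ρ t‖
      simp) |>.mul_const C)
    (Eventually.of_forall fun t s _ =>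
      (hasDerivAt_comp_line (hg.differentiable (by norm_num)) (x - t) i s).const_mul (ρ t))).2
  have hline := hasDerivAt_comp_line hsmooth x i 0
  have heq : (fun s : ℝ => ∫ t, ρ t * g ((x - t) + s • e))
      = fun s : ℝ => (ρ ⋆[lsmul ℝ ℝ] g) (x + s • e) := by
    ext s
    simp only [convolution, ContinuousLinearMap.lsmul_apply, smul_eq_mul]
    refine integral_congr_ae (Eventually.of_forall fun t => ?_)
    simp only [sub_add_eq_add_sub]
  rw [heq] at key
  have := hline.unique key
  simpa [convolution] using this

variable (η : ℝ) (l : ι) {v g χ : EuclideanSpace ℝ ι → ℝ}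

theorem partialDeriv_log_eq (hv : Differentiable ℝ v) (hpos : ∀ x, 0 < v x) (j : ι) :
    partialDeriv j (fun y => Real.log (v y)) = fun y => partialDeriv j v y / v y :=
  funext fun y => partialDeriv_log (hv y) (hpos y).ne'

/-- Since `Δ log v = Δv / v - |∇ log v|²`, the quadratic gradient terms cancel. -/
theorem sumSecondDeriv_add_waveExcess_log (hv : ContDiff ℝ 2 v) (hpos : ∀ x, 0 < v x)
    (y : EuclideanSpace ℝ ι) :
    sumSecondDeriv (fun y => Real.log (v y)) y + waveExcess η l (fun y => Real.log (v y)) y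
      = (sumSecondDeriv v y - η * partialDeriv l v y) / v y := by
  have hd : Differentiable ℝ v := hv.differentiable (by norm_num)
  have hd1 : ∀ j, Differentiable ℝ (partialDeriv j v) := fun j =>
    (hv.partialDeriv (m := 1) (by norm_num) j).differentiable (by norm_num)
  simp only [sumSecondDeriv, waveExcess, partialDeriv_log_eq hd hpos]
  simp_rw [fun i => partialDeriv_div (i := i) (hd1 i y) (hd y) (hpos y).ne']
  rw [sub_div, Finset.sum_div, ← add_sub_assoc, ← Finset.sum_add_distrib]
  congr 1
  · refine Finset.sum_congr rfl fun j _ => ?_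
    ring
  · ring

/-- The maximum principle for `χ (|∇ log v|² - η ∂ₗ log v)` where `v` is merely `C²`. -/
theorem exists_waveExcess_inequality (hv : ContDiff ℝ 2 v) (hpos : ∀ x, 0 < v x)
    (hg : ContDiff ℝ 1 g) (heq : ∀ x, sumSecondDeriv v x = η * partialDeriv l v x + g x)
    (hχ : ContDiff ℝ 2 χ) (hχ0 : ∀ x, 0 ≤ χ x) {z : EuclideanSpace ℝ ι} {R : ℝ} (hR : 0 ≤ R)
    (hχb : ∀ x ∈ Metric.sphere z R, χ x = 0) (hχz : 0 < χ z)
    (hz : 0 < waveExcess η l (fun y => Real.log (v y)) z) :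
    ∃ x ∈ Metric.closedBall z R,
      χ z * waveExcess η l (fun y => Real.log (v y)) z
        ≤ χ x * waveExcess η l (fun y => Real.log (v y)) x ∧
      2 * χ x ^ 2 * (g x / v x - waveExcess η l (fun y => Real.log (v y)) x) ^ 2
      + Fintype.card ι * (2 * χ x ^ 2 *
          ∑ j, partialDeriv j v x / v x * (partialDeriv j g x / v x
            - g x * partialDeriv j v x / v x ^ 2)
        - η * χ x ^ 2 * (partialDeriv l g x / v x - g x * partialDeriv l v x / v x ^ 2)
        + 2 * (χ x * waveExcess η l (fun y => Real.log (v y)) x) *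
          ∑ j, partialDeriv j v x / v x * partialDeriv j χ x
        - η * (χ x * waveExcess η l (fun y => Real.log (v y)) x) * partialDeriv l χ x
        - 2 * waveExcess η l (fun y => Real.log (v y)) x * ∑ j, partialDeriv j χ x ^ 2
        + χ x * waveExcess η l (fun y => Real.log (v y)) x * sumSecondDeriv χ x) ≤ 0 := by
  let φ : ℕ → ContDiffBump (0 : EuclideanSpace ℝ ι) := fun k =>
    ⟨1 / ((k : ℝ) + 1) / 2, 1 / ((k : ℝ) + 1), by positivity, half_lt_self (by positivity)⟩
  have hφ : Tendsto (fun k => (φ k).rOut) atTop (𝓝 0) := tendsto_one_div_add_atTop_nhds_zero_nat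
  let M : ℕ → (EuclideanSpace ℝ ι → ℝ) → EuclideanSpace ℝ ι → ℝ := fun k h =>
    (φ k).normed volume ⋆[lsmul ℝ ℝ] h
  have hMlim : ∀ {h : EuclideanSpace ℝ ι → ℝ}, Continuous h → ∀ {s : ℕ → ℕ},
      Tendsto s atTop atTop → ∀ {y : ℕ → EuclideanSpace ℝ ι} {y₀ : EuclideanSpace ℝ ι},
      Tendsto y atTop (𝓝 y₀) → Tendsto (fun k => M (s k) h (y k)) atTop (𝓝 (h y₀)) := by
    intro h hh s hs y y₀ hy
    exact ContDiffBump.convolution_tendsto_right (φ := fun k => φ (s k)) (g := fun _ => h)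
      (hφ.comp hs) (Eventually.of_forall fun _ => hh.aestronglyMeasurable)
      ((hh.tendsto y₀).comp tendsto_snd) hy
  have hMsmooth : ∀ k {h : EuclideanSpace ℝ ι → ℝ}, Continuous h → ContDiff ℝ 3 (M k h) :=
    fun k h hh => (φ k).hasCompactSupport_normed.contDiff_convolution_left (n := 3) (lsmul ℝ ℝ)
      (φ k).contDiff_normed hh.locallyIntegrable
  have hMd : ∀ k {h : EuclideanSpace ℝ ι → ℝ}, ContDiff ℝ 1 h → ∀ i,
      partialDeriv i (M k h) = M k (partialDeriv i h) := fun k h hh i =>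
    partialDeriv_convolution (φ k).hasCompactSupport_normed (φ k).contDiff_normed hh i
  have hvc := hv.continuous
  have hgc := hg.continuous
  have hv1 : ContDiff ℝ 1 v := hv.of_le (by norm_num)
  have hc1 : ∀ j, ContDiff ℝ 1 (partialDeriv j v) := fun j => hv.partialDeriv (by norm_num) j
  have hc2 : ∀ j, Continuous (partialDeriv j (partialDeriv j v)) := fun j =>
    ((hc1 j).partialDeriv (m := 0) (by norm_num) j).continuous
  have hgd : ∀ j, Continuous (partialDeriv j g) := fun j =>
    (hg.partialDeriv (m := 0) (by norm_num) j).continuous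
  have hMpos : ∀ k y, 0 < M k v y := fun k y => convolution_pos hvc hpos y
  -- With `g` treated as a given source the equation is linear with constant coefficients, so
  -- mollification preserves it.
  have hMeq : ∀ k y, sumSecondDeriv (M k v) y - η * partialDeriv l (M k v) y = M k g y := by
    intro k y
    have hint : ∀ {h : EuclideanSpace ℝ ι → ℝ}, Continuous h →
        Integrable fun t => (φ k).normed volume t * h (y - t) := fun hh =>
      ((φ k).continuous_normed.mul (by fun_prop)).integrable_of_hasCompactSupport
        (φ k).hasCompactSupport_normed.mul_right
    simp only [sumSecondDeriv]
    simp_rw [fun j => hMd k hv1 j, fun j => hMd k (hc1 j) j]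
    simp only [M, convolution, ContinuousLinearMap.lsmul_apply, smul_eq_mul]
    rw [← integral_finsetSum _ fun j _ => hint (hc2 j), ← integral_const_mul,
      ← integral_sub (integrable_finsetSum _ fun j _ => hint (hc2 j))
        ((hint (hc1 l).continuous).const_mul η)]
    refine integral_congr_ae (Eventually.of_forall fun t => ?_)
    have := heq (y - t)
    simp only [sumSecondDeriv] at this
    simp only [← Finset.mul_sum, this]
    ring
  let w : ℕ → EuclideanSpace ℝ ι → ℝ := fun k y => Real.log (M k v y)
  have hw : ∀ k, ContDiff ℝ 3 (w k) := fun k => (hMsmooth k hvc).log fun y => (hMpos k y).ne'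
  have hwd : ∀ k j, partialDeriv j (w k) = fun y => M k (partialDeriv j v) y / M k v y := by
    intro k j
    rw [partialDeriv_log_eq ((hMsmooth k hvc).differentiable (by norm_num)) (hMpos k), hMd k hv1]
  have hPlim : ∀ {s : ℕ → ℕ}, Tendsto s atTop atTop → ∀ {y : ℕ → EuclideanSpace ℝ ι}
      {y₀ : EuclideanSpace ℝ ι}, Tendsto y atTop (𝓝 y₀) →
      Tendsto (fun k => waveExcess η l (w (s k)) (y k)) atTop
        (𝓝 (waveExcess η l (fun y => Real.log (v y)) y₀)) := by
    intro s hs y y₀ hy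
    simp only [waveExcess, hwd, partialDeriv_log_eq (hv1.differentiable (by norm_num)) hpos]
    have hq : ∀ j, Tendsto (fun k => M (s k) (partialDeriv j v) (y k) / M (s k) v (y k)) atTop
        (𝓝 (partialDeriv j v y₀ / v y₀)) := fun j =>
      (hMlim (hc1 j).continuous hs hy).div (hMlim hvc hs hy) (hpos y₀).ne'
    exact (tendsto_finsetSum _ fun j _ => (hq j).pow 2).sub ((hq l).const_mul η)
  have hPc : ∀ k, Continuous (waveExcess η l (w k)) := fun k =>
    ((hw k).waveExcess (m := 2) η l (by norm_num)).continuous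
  choose y hyK hymax using fun k => (isCompact_closedBall z R).exists_isMaxOn
    ⟨z, Metric.mem_closedBall_self hR⟩ (hχ.continuous.mul (hPc k)).continuousOn
  obtain ⟨x, hxK, s, hs, hx⟩ := (isCompact_closedBall z R).tendsto_subseq hyK
  have hs' := hs.tendsto_atTop
  have hPx := hPlim hs' hx
  have hPz := hPlim hs' (tendsto_const_nhds (x := z))
  have hχx : Tendsto (fun k => χ (y (s k))) atTop (𝓝 (χ x)) := (hχ.continuous.tendsto x).comp hx
  have hmax : ∀ k, χ z * waveExcess η l (w (s k)) z
      ≤ χ (y (s k)) * waveExcess η l (w (s k)) (y (s k)) := fun k =>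
    hymax (s k) (Metric.mem_closedBall_self hR)
  refine ⟨x, hxK, le_of_tendsto_of_tendsto' (hPz.const_mul _) (hχx.mul hPx) hmax, ?_⟩
  -- Once the mollified excess is positive at `z`, the maximizer cannot lie on the sphere, where `χ
  -- = 0`; it is then an interior local maximum.
  have hineq : ∀ᶠ k in atTop, _ := (hPz.eventually_const_lt hz).mono fun k hk => by
    have hne : χ (y (s k)) ≠ 0 := by
      intro h0
      have := hmax k
      rw [h0, zero_mul] at this
      exact absurd (mul_pos hχz hk) (not_lt.2 this)
    have hball : y (s k) ∈ Metric.ball z R := by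
      rw [Metric.mem_ball]
      refine lt_of_le_of_ne (hyK (s k)) fun h => hne (hχb _ h)
    have hloc : IsLocalMax (fun q => χ q * waveExcess η l (w (s k)) q) (y (s k)) :=
      (hymax (s k)).isLocalMax (mem_of_superset (Metric.isOpen_ball.mem_nhds hball)
        Metric.ball_subset_closedBall)
    exact hloc.waveExcess_inequality η l (hw (s k)) hχ (hχ0 _)
      (S := fun q => M (s k) g q / M (s k) v q) fun q => by
        rw [← hMeq]
        exact (sumSecondDeriv_add_waveExcess_log η l ((hMsmooth _ hvc).of_le (by norm_num))
          (hMpos _) q).symm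
  have hSd : ∀ k j q, partialDeriv j (fun q => M k g q / M k v q) q
      = M k (partialDeriv j g) q / M k v q
        - M k g q * M k (partialDeriv j v) q / M k v q ^ 2 := by
    intro k j q
    rw [partialDeriv_div ((hMsmooth k hgc).differentiable (by norm_num) q)
      ((hMsmooth k hvc).differentiable (by norm_num) q) (hMpos k q).ne', hMd k hg, hMd k hv1]
  simp only [hwd, hSd] at hineq
  have tv := hMlim hvc hs' hx
  have tg := hMlim hgc hs' hx
  have tvd := fun j => hMlim (hc1 j).continuous hs' hx
  have tgd := fun j => hMlim (hgd j) hs' hx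
  have tχd : ∀ j, Tendsto (fun k => partialDeriv j χ (y (s k))) atTop (𝓝 (partialDeriv j χ x)) :=
    fun j => ((hχ.partialDeriv (m := 0) (by norm_num) j).continuous.tendsto x).comp hx
  have tχL : Tendsto (fun k => sumSecondDeriv χ (y (s k))) atTop (𝓝 (sumSecondDeriv χ x)) :=
    ((hχ.sumSecondDeriv (m := 0) (by norm_num)).continuous.tendsto x).comp hx
  have hne := (hpos x).ne'
  have tq := fun j => (tvd j).div tv hne
  have tS := fun j => ((tgd j).div tv hne).sub ((tg.mul (tvd j)).div (tv.pow 2) (pow_ne_zero 2 hne))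
  -- The second derivatives of `log v` were absorbed into `S - P`, so every term left is continuous
  -- under the convergence at hand.
  refine le_of_tendsto ?_ hineq
  exact (((hχx.pow 2).const_mul 2).mul (((tg.div tv hne).sub hPx).pow 2)).add
    (((((((((hχx.pow 2).const_mul 2).mul (tendsto_finsetSum _ fun j _ => (tq j).mul (tS j))).sub
      (((hχx.pow 2).const_mul η).mul (tS l))).add
      (((hχx.mul hPx).const_mul 2).mul (tendsto_finsetSum _ fun j _ => (tq j).mul (tχd j)))).sub
      (((hχx.mul hPx).const_mul η).mul (tχd l))).sub
      ((hPx.const_mul 2).mul (tendsto_finsetSum _ fun j _ => (tχd j).pow 2))).add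
      ((hχx.mul hPx).mul tχL)).const_mul _)

end Mollification

/-! ### The cutoff `(R² - |x - z|²)²` and its derivatives. -/

section Cutoff

variable {ι : Type*} [Fintype ι] (z : EuclideanSpace ℝ ι) (R : ℝ)

theorem contDiff_coord (j : ι) {n : WithTop ℕ∞} :
    ContDiff ℝ n fun y : EuclideanSpace ℝ ι => y j - z j :=
  (EuclideanSpace.proj j : EuclideanSpace ℝ ι →L[ℝ] ℝ).contDiff.sub contDiff_const

/-- The function `R² - |x - z|²`. -/
noncomputable def paraboloid : EuclideanSpace ℝ ι → ℝ :=
  fun x => R ^ 2 - ∑ j, (x j - z j) ^ 2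

theorem paraboloid_eq (x : EuclideanSpace ℝ ι) : paraboloid z R x = R ^ 2 - dist x z ^ 2 := by
  rw [paraboloid, dist_eq_norm, EuclideanSpace.norm_sq_eq]
  simp

theorem contDiff_paraboloid {n : WithTop ℕ∞} : ContDiff ℝ n (paraboloid z R) :=
  contDiff_const.sub (ContDiff.sum fun j _ => (contDiff_coord z j).pow 2)

variable [DecidableEq ι]

theorem partialDeriv_coord (x : EuclideanSpace ℝ ι) (i j : ι) :
    partialDeriv i (fun y : EuclideanSpace ℝ ι => y j - z j) x = if j = i then 1 else 0 := by
  have h : HasFDerivAt (fun y : EuclideanSpace ℝ ι => y j - z j)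
      (EuclideanSpace.proj j : EuclideanSpace ℝ ι →L[ℝ] ℝ) x :=
    (EuclideanSpace.proj j : EuclideanSpace ℝ ι →L[ℝ] ℝ).hasFDerivAt.sub_const _
  simp [partialDeriv, h.fderiv]

theorem partialDeriv_paraboloid (x : EuclideanSpace ℝ ι) (i : ι) :
    partialDeriv i (paraboloid z R) x = -2 * (x i - z i) := by
  have hd : ∀ j, Differentiable ℝ fun y : EuclideanSpace ℝ ι => y j - z j := fun j =>
    (contDiff_coord z j (n := 1)).differentiable (by norm_num)
  unfold paraboloid
  rw [partialDeriv_sub (by fun_prop) (by fun_prop), partialDeriv_const,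
    partialDeriv_sum _ fun j _ => by fun_prop]
  simp_rw [fun j => partialDeriv_pow (i := i) 2 (hd j x), partialDeriv_coord]
  simp

theorem partialDeriv_paraboloid_sq (i : ι) :
    partialDeriv i (fun x => paraboloid z R x ^ 2)
      = fun x => -4 * (paraboloid z R x * (x i - z i)) := by
  ext x
  rw [partialDeriv_pow _ ((contDiff_paraboloid z R (n := 1)).differentiable (by norm_num) x),
    partialDeriv_paraboloid]
  norm_num
  ring

theorem sumSecondDeriv_paraboloid_sq (x : EuclideanSpace ℝ ι) :
    sumSecondDeriv (fun x => paraboloid z R x ^ 2) x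
      = 8 * ∑ j, (x j - z j) ^ 2 - 4 * Fintype.card ι * paraboloid z R x := by
  have hψ : Differentiable ℝ (paraboloid z R) :=
    (contDiff_paraboloid z R (n := 1)).differentiable (by norm_num)
  have hd : ∀ j, Differentiable ℝ fun y : EuclideanSpace ℝ ι => y j - z j := fun j =>
    (contDiff_coord z j (n := 1)).differentiable (by norm_num)
  have h : ∀ i, partialDeriv i (partialDeriv i fun x => paraboloid z R x ^ 2) x
      = 8 * (x i - z i) ^ 2 - 4 * paraboloid z R x := by
    intro i
    rw [partialDeriv_paraboloid_sq,
      partialDeriv_const_mul _ (by fun_prop), partialDeriv_mul (hψ x) (hd i x),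
      partialDeriv_coord, partialDeriv_paraboloid, if_pos rfl]
    ring
  simp only [sumSecondDeriv, h, Finset.sum_sub_distrib, ← Finset.mul_sum]
  simp
  ring

end Cutoff

/-! ### The gradient estimate for the profile. -/

section GradientEstimate

theorem quadratic_bound_contradiction {K L t r : ℝ} (hK : 0 ≤ K) (hL : 0 ≤ L)
    (hr : K + L + 1 ≤ r) (ht : r ≤ t) : ¬ t ^ 2 ≤ K * t + L := by
  intro h
  nlinarith [mul_nonneg hK hL]

theorem le_add_of_sq_le_sq_add_mul {s r e : ℝ} (hr : 0 ≤ r) (he : 0 ≤ e)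
    (h : s ^ 2 ≤ r ^ 2 + e * s) : s ≤ e + r := by
  by_contra! hcon
  nlinarith [mul_nonneg he hr]

/-- Put `t = m / R`. Then `t ≥ R c`, so the term `12 |η| R` is at most `(12 |η| / c) t` and the
bound becomes `t² ≤ K t + L`. The radius is chosen so that `R c = K + L + 1`, which rules this out.
-/
theorem cutoff_bound_contradiction {N c R m η : ℝ} (hN : 0 ≤ N) (hc : 0 < c)
    (hRdef : R = (N * (8 + 12 * |η| / c) + N * (32 + 4 * N) + 1) / c) (hR : 0 < R)
    (hmlow : R ^ 2 * c ≤ m) :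
    ¬ m ^ 2 ≤ N * (8 * R * m + 12 * |η| * R ^ 3 + (32 + 4 * N) * R ^ 2) := by
  intro hbound
  have hRc : R * c = N * (8 + 12 * |η| / c) + N * (32 + 4 * N) + 1 := by rw [hRdef]; field_simp
  have ht : R * c ≤ m / R := by
    rw [le_div_iff₀ hR]
    linarith
  refine quadratic_bound_contradiction (K := N * (8 + 12 * |η| / c))
    (L := N * (32 + 4 * N)) (by positivity) (by positivity) hRc.ge ht ?_
  have hηR : 12 * |η| * R ≤ 12 * |η| / c * (m / R) := by
    calc 12 * |η| * R = 12 * |η| / c * (R * c) := by field_simp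
      _ ≤ _ := by gcongr
  have hdiv : (m / R) ^ 2 ≤ N * (8 * (m / R) + 12 * |η| * R + (32 + 4 * N)) := by
    rw [div_pow, div_le_iff₀ (by positivity)]
    refine hbound.trans (le_of_eq ?_)
    field_simp
  refine hdiv.trans ?_
  have := mul_le_mul_of_nonneg_left hηR hN
  linarith

/-- Algebra at the maximum point: `q = b v²`, `G = |∇w|²`, `y = |x - z|`, and `A` is the inner
product of `∇w` with `x - z`. The main terms dominate `ψ⁴ P²`, and one factor `ψ² P` cancels. -/
theorem sq_le_of_maximum_inequality {a q P G N ψ η y yl A B : ℝ} (ha : 0 ≤ a) (hq : 0 ≤ q)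
    (hP : 0 < P) (hG : 0 ≤ G) (hN : 1 ≤ N) (hψ : 0 < ψ)
    (hA : A ≤ √G * y) (hyl : |yl| ≤ y)
    (hB : 2 * (ψ ^ 2) ^ 2 * (q - a - P) ^ 2 + N * (2 * (ψ ^ 2) ^ 2 * (q * (P + G))
      - 8 * ψ ^ 3 * P * A + 4 * η * ψ ^ 3 * P * yl
      - 32 * P * ψ ^ 2 * y ^ 2 + ψ ^ 2 * P * (8 * y ^ 2 - 4 * N * ψ)) ≤ B) (hB0 : B ≤ 0) :
    ψ ^ 2 * P ≤ N * (8 * ψ * (√G * y) + 4 * |η| * ψ * y + 32 * y ^ 2 + 4 * N * ψ) := by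
  have hmain : P ^ 2 / 2 ≤ (q - a - P) ^ 2 + N * (q * (P + G)) := by
    have h1 : q * P ≤ N * (q * (P + G)) := by
      have : q * P ≤ q * (P + G) := by nlinarith
      nlinarith [mul_nonneg hq (by linarith : 0 ≤ P + G)]
    -- If `q ≤ a`, the square alone is at least `P²`. If `s = q - a ≥ 0`, then `q P ≥ s P` and `s² -
    -- s P + P² ≥ 3 P² / 4`.
    have h2 : P ^ 2 / 2 ≤ (q - a - P) ^ 2 + q * P := by
      rcases le_total q a with h | h
      · nlinarith [mul_nonneg (sub_nonneg.2 h) hP.le, mul_nonneg hq hP.le, sq_nonneg (q - a)]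
      · nlinarith [sq_nonneg (2 * (q - a) - P), mul_nonneg ha hP.le]
    linarith
  have hηy : -(η * yl) ≤ |η| * y := by
    refine (neg_le_abs _).trans ?_
    rw [abs_mul]
    exact mul_le_mul_of_nonneg_left hyl (abs_nonneg _)
  have h1 := mul_le_mul_of_nonneg_left hmain (by positivity : 0 ≤ 2 * (ψ ^ 2) ^ 2)
  have h2 := mul_le_mul_of_nonneg_left hA (by positivity : 0 ≤ N * (8 * ψ ^ 3 * P))
  have h3 := mul_le_mul_of_nonneg_left hηy (by positivity : 0 ≤ N * (4 * ψ ^ 3 * P))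
  have h4 : 0 ≤ N * (ψ ^ 2 * P * (8 * y ^ 2)) := by positivity
  have h5 : (ψ ^ 2 * P) * (ψ ^ 2 * P) ≤ (ψ ^ 2 * P) *
      (N * (8 * ψ * (√G * y) + 4 * |η| * ψ * y + 32 * y ^ 2 + 4 * N * ψ)) := by
    linarith
  exact le_of_mul_le_mul_left h5 (by positivity)

variable {ι : Type*} [Fintype ι] [DecidableEq ι] {l : ι} {a b η : ℝ}
  {v : EuclideanSpace ℝ ι → ℝ}

/-- The gradient estimate for positive entire solutions of `Δ v = η ∂ₗ v - a v + b v³`. -/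
theorem waveExcess_log_nonpos (ha : 0 ≤ a) (hb : 0 ≤ b) (hv : ContDiff ℝ 2 v)
    (hpos : ∀ x, 0 < v x)
    (heq : ∀ x, sumSecondDeriv v x = η * partialDeriv l v x + (b * v x ^ 3 - a * v x))
    (z : EuclideanSpace ℝ ι) : waveExcess η l (fun y => Real.log (v y)) z ≤ 0 := by
  by_contra! hz
  set N : ℝ := (Fintype.card ι : ℝ) with hN
  have hN1 : 1 ≤ N := by
    have : Nonempty ι := ⟨l⟩
    rw [hN]
    exact Nat.one_le_cast.2 Fintype.card_pos
  set c := √(waveExcess η l (fun y => Real.log (v y)) z) with hc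
  have hc0 : 0 < c := Real.sqrt_pos.2 hz
  have hcsq : c ^ 2 = waveExcess η l (fun y => Real.log (v y)) z := Real.sq_sqrt hz.le
  obtain ⟨R, hRdef⟩ : ∃ R, R = (N * (8 + 12 * |η| / c) + N * (32 + 4 * N) + 1) / c := ⟨_, rfl⟩
  have hR : 0 < R := by
    rw [hRdef]
    positivity
  have hvd : Differentiable ℝ v := hv.differentiable (by norm_num)
  have hψz : paraboloid z R z = R ^ 2 := by simp [paraboloid_eq]
  obtain ⟨x, hxK, hxz, hx⟩ := exists_waveExcess_inequality (z := z) (R := R)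
    (g := fun x => b * v x ^ 3 - a * v x) (χ := fun x => paraboloid z R x ^ 2) η l hv hpos
    ((contDiff_const.mul ((hv.of_le (by norm_num)).pow 3)).sub
      (contDiff_const.mul (hv.of_le (by norm_num)))) heq
    ((contDiff_paraboloid z R).pow 2) (fun x => sq_nonneg _) hR.le
    (fun x hx => by simp [paraboloid_eq, Metric.mem_sphere.1 hx])
    (by simp only [hψz]; positivity) hz
  rw [hψz, ← hcsq] at hxz
  have hgd : ∀ j, partialDeriv j (fun x => b * v x ^ 3 - a * v x) x
      = (3 * b * v x ^ 2 - a) * partialDeriv j v x := by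
    intro j
    have := hvd x
    rw [partialDeriv_sub (by fun_prop) (by fun_prop), partialDeriv_const_mul _ (by fun_prop),
      partialDeriv_const_mul _ this, partialDeriv_pow _ this]
    norm_num
    ring
  have hV := hpos x
  -- This is `∂ⱼS = 2 q ∂ⱼw`: the contributions of `a` cancel.
  have hSd : ∀ j, (3 * b * v x ^ 2 - a) * partialDeriv j v x / v x
      - (b * v x ^ 3 - a * v x) * partialDeriv j v x / v x ^ 2
      = 2 * (b * v x ^ 2) * (partialDeriv j v x / v x) := by
    intro j
    field_simp
    ring
  have hS : (b * v x ^ 3 - a * v x) / v x = b * v x ^ 2 - a := by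
    field_simp
  have hPdef : waveExcess η l (fun y => Real.log (v y)) x
      = ∑ j, (partialDeriv j v x / v x) ^ 2 - η * (partialDeriv l v x / v x) := by
    simp only [waveExcess, partialDeriv_log_eq hvd hpos]
  simp only [hgd, hSd, hS, partialDeriv_paraboloid_sq, sumSecondDeriv_paraboloid_sq] at hx
  set P := waveExcess η l (fun y => Real.log (v y)) x
  obtain ⟨p, hp⟩ : ∃ p : ι → ℝ, ∀ j, partialDeriv j v x / v x = p j := ⟨_, fun _ => rfl⟩
  simp only [hp] at hx hPdef
  set G := ∑ j, p j ^ 2 with hG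
  set ψ := paraboloid z R x with hψ
  set q := b * v x ^ 2 with hq
  set y := dist x z with hy
  have hysq : ∑ j, (x j - z j) ^ 2 = y ^ 2 := by
    rw [hy, dist_eq_norm, EuclideanSpace.norm_sq_eq]
    simp
  have hyR : y ≤ R := hxK
  have hy0 : 0 ≤ y := dist_nonneg
  have hψy : ψ = R ^ 2 - y ^ 2 := paraboloid_eq z R x
  have hψ0 : 0 ≤ ψ := by
    rw [hψy]
    exact sub_nonneg.2 (pow_le_pow_left₀ hy0 hyR 2)
  have hψR : ψ ≤ R ^ 2 := by
    rw [hψy]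
    exact sub_le_self _ (sq_nonneg y)
  have hlow : (0 : ℝ) < (R ^ 2) ^ 2 * c ^ 2 := by positivity
  -- On the sphere `χ P` would vanish, contradicting its lower bound by the positive value at `z`.
  have hψpos : 0 < ψ := by
    refine lt_of_le_of_ne hψ0 fun h => ?_
    rw [← h] at hxz
    simp only [ne_eq, OfNat.ofNat_ne_zero, not_false_eq_true, zero_pow, zero_mul] at hxz
    linarith
  have hPpos : 0 < P := pos_of_mul_pos_right (hlow.trans_le hxz) (sq_nonneg ψ)
  have hG0 : 0 ≤ G := Finset.sum_nonneg fun j _ => sq_nonneg _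
  have hq0 : 0 ≤ q := by positivity
  have hA : ∑ j, p j * (x j - z j) ≤ √G * y := by
    have := Real.sum_mul_le_sqrt_mul_sqrt Finset.univ p fun j => x j - z j
    rwa [hysq, Real.sqrt_sq hy0] at this
  have hyl : |x l - z l| ≤ y := by
    refine abs_le_of_sq_le_sq ?_ hy0
    rw [← hysq]
    exact Finset.single_le_sum (f := fun j => (x j - z j) ^ 2) (fun j _ => sq_nonneg _)
      (Finset.mem_univ l)
  have hpl : |p l| ≤ √G := Real.abs_le_sqrt
    (Finset.single_le_sum (f := fun j => p j ^ 2) (fun j _ => sq_nonneg _) (Finset.mem_univ l))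
  -- From `G = P + η ∂ₗw ≤ P + |η| √G`; this trades the full gradient for `P`.
  have hsqG : √G ≤ |η| + √P := by
    have h1 : √G ^ 2 ≤ √P ^ 2 + |η| * √G := by
      rw [Real.sq_sqrt hG0, Real.sq_sqrt hPpos.le]
      have : η * p l ≤ |η| * √G := (le_abs_self _).trans (by
        rw [abs_mul]
        exact mul_le_mul_of_nonneg_left hpl (abs_nonneg _))
      linarith
    exact le_add_of_sq_le_sq_add_mul (Real.sqrt_nonneg P) (abs_nonneg η) h1
  have hsum1 : ∑ j, p j * (2 * q * p j) = 2 * q * G := by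
    rw [hG, Finset.mul_sum]
    exact Finset.sum_congr rfl fun j _ => by ring
  have hsum2 : ∑ j, p j * (-4 * (ψ * (x j - z j))) = -4 * ψ * ∑ j, p j * (x j - z j) := by
    rw [Finset.mul_sum]
    exact Finset.sum_congr rfl fun j _ => by ring
  have hsum3 : ∑ j, (-4 * (ψ * (x j - z j))) ^ 2 = 16 * ψ ^ 2 * y ^ 2 := by
    rw [← hysq, Finset.mul_sum]
    exact Finset.sum_congr rfl fun j _ => by ring
  rw [hsum1, hsum2, hsum3, hysq] at hx
  -- The identity `P = G - η pₗ` rewrites `4 q G - 2 η q pₗ` as `2 q (P + G)`.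
  have hx' := sq_le_of_maximum_inequality (a := a) (η := η) (yl := x l - z l) ha hq0 hPpos hG0
    hN1 hψpos hA hyl (le_of_eq (by
      linear_combination (N * (2 * (ψ ^ 2) ^ 2 * q)) * hPdef)) hx
  set m := ψ * √P with hm
  have hm2 : m ^ 2 = ψ ^ 2 * P := by rw [hm, mul_pow, Real.sq_sqrt hPpos.le]
  have hm0 : 0 < m := mul_pos hψpos (Real.sqrt_pos.2 hPpos)
  have hmlow : R ^ 2 * c ≤ m := by
    refine le_of_sq_le_sq ?_ hm0.le
    rw [hm2, mul_pow]
    exact hxz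
  -- The constant 12 is 8 from replacing `√G` by `|η| + √P`, plus 4 from the drift term `η ∂ₗχ`.
  have hbound : m ^ 2 ≤ N * (8 * R * m + 12 * |η| * R ^ 3 + (32 + 4 * N) * R ^ 2) := by
    rw [hm2]
    refine hx'.trans (mul_le_mul_of_nonneg_left ?_ (by linarith))
    have e1 : 8 * ψ * (√G * y) ≤ 8 * R * m + 8 * |η| * R ^ 3 := by
      calc 8 * ψ * (√G * y) ≤ 8 * ψ * ((|η| + √P) * R) := by gcongr
        _ = 8 * R * m + 8 * |η| * R * ψ := by rw [hm]; ring
        _ ≤ 8 * R * m + 8 * |η| * R * R ^ 2 := by gcongr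
        _ = _ := by ring
    have e2 : 4 * |η| * ψ * y ≤ 4 * |η| * R ^ 3 := by
      calc 4 * |η| * ψ * y ≤ 4 * |η| * R ^ 2 * R := by gcongr
        _ = _ := by ring
    have e3 : 32 * y ^ 2 ≤ 32 * R ^ 2 := by gcongr
    have e4 : 4 * N * ψ ≤ 4 * N * R ^ 2 := by gcongr
    linarith
  exact cutoff_bound_contradiction (by linarith) hc0 hRdef hR hmlow hbound

theorem norm_gradient_le_of_waveExcess_log_nonpos (hv : Differentiable ℝ v)
    (hpos : ∀ x, 0 < v x) {z : EuclideanSpace ℝ ι}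
    (h : waveExcess η l (fun y => Real.log (v y)) z ≤ 0) : ‖gradient v z‖ ≤ |η| * v z := by
  simp only [waveExcess, partialDeriv_log_eq hv hpos] at h
  have hV := hpos z
  have hle : |partialDeriv l v z| ≤ ‖gradient v z‖ := by
    refine abs_le_of_sq_le_sq ?_ (norm_nonneg _)
    rw [norm_gradient_sq]
    exact Finset.single_le_sum (f := fun j => partialDeriv j v z ^ 2) (fun j _ => sq_nonneg _)
      (Finset.mem_univ l)
  have h1 : ‖gradient v z‖ ^ 2 ≤ η * partialDeriv l v z * v z := by
    simp_rw [div_pow, ← Finset.sum_div, ← norm_gradient_sq] at h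
    rw [sub_nonpos, mul_div_assoc', div_le_div_iff₀ (by positivity) hV] at h
    refine le_of_mul_le_mul_right (a := v z) ?_ hV
    linarith
  have h2 : η * partialDeriv l v z ≤ |η| * ‖gradient v z‖ := (le_abs_self _).trans (by
    rw [abs_mul]
    exact mul_le_mul_of_nonneg_left hle (abs_nonneg _))
  have h3 := mul_le_mul_of_nonneg_right h2 hV.le
  -- A factor `‖∇v‖` is cancelled, so a vanishing gradient is treated apart.
  rcases (norm_nonneg (gradient v z)).eq_or_lt with h0 | h0
  · rw [← h0]
    positivity
  · refine le_of_mul_le_mul_left (a := ‖gradient v z‖) ?_ h0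
    linarith

end GradientEstimate

/-! ### From the traveling wave to its profile. -/

theorem IsTravelingWave.profile_eq {d : ℕ} {f : EuclideanSpace ℝ (Fin (d + 1)) → ℝ → ℝ}
    {v : EuclideanSpace ℝ (Fin (d + 1)) → ℝ} {η : ℝ} (hwave : IsTravelingWave f v η)
    {t : ℝ} (ht : 0 ≤ t) (x : EuclideanSpace ℝ (Fin (d + 1))) :
    v x = f (x - EuclideanSpace.single (Fin.last d) (η * t)) t := by
  rw [hwave _ t ht, sub_add_cancel]

/-- The profile is a translate of the slice at time 1; time 0 would not do, as regularity is assumed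
only at positive times. -/
theorem IsNewellWhiteheadSolution.contDiff_profile {d : ℕ} {a b η : ℝ}
    {f : EuclideanSpace ℝ (Fin (d + 1)) → ℝ → ℝ} {v : EuclideanSpace ℝ (Fin (d + 1)) → ℝ}
    (hsol : IsNewellWhiteheadSolution a b f) (hwave : IsTravelingWave f v η) :
    ContDiff ℝ 2 v := by
  rw [funext (hwave.profile_eq zero_le_one)]
  exact (hsol.contDiff_space 1 one_pos).comp (contDiff_id.sub contDiff_const)

theorem IsNewellWhiteheadSolution.profile_equation {d : ℕ} {a b η : ℝ}
    {f : EuclideanSpace ℝ (Fin (d + 1)) → ℝ → ℝ} {v : EuclideanSpace ℝ (Fin (d + 1)) → ℝ}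
    (hsol : IsNewellWhiteheadSolution a b f) (hwave : IsTravelingWave f v η)
    (z : EuclideanSpace ℝ (Fin (d + 1))) :
    sumSecondDeriv v z
      = η * partialDeriv (Fin.last d) v z + (b * v z ^ 3 - a * v z) := by
  have hv := hsol.contDiff_profile hwave
  set e : EuclideanSpace ℝ (Fin (d + 1)) := EuclideanSpace.single (Fin.last d) 1 with he
  have hsingle : ∀ s : ℝ, EuclideanSpace.single (Fin.last d) s = s • e := fun s => by
    rw [he]
    ext i
    simp
  -- The point that the wave carries to `z` at time 1.
  set x := z - (η * 1) • e with hx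
  have hxz : x + (η * 1) • e = z := sub_add_cancel _ _
  have hf1 : f x 1 = v z := by rw [hwave x 1 zero_le_one, hsingle, hxz]
  have htime : deriv (fun s => f x s) 1 = η * partialDeriv (Fin.last d) v z := by
    have hev : (fun s => f x s) =ᶠ[𝓝 1] fun s => v (x + (η * s) • e) := by
      filter_upwards [lt_mem_nhds (zero_lt_one : (0 : ℝ) < 1)] with s hs
      rw [hwave x s hs.le, hsingle]
    have hline := hasDerivAt_comp_line (hv.differentiable (by norm_num)) x (Fin.last d) (η * 1)
    have hcomp := hline.comp (1 : ℝ) ((hasDerivAt_id (1 : ℝ)).const_mul η)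
    rw [hev.deriv_eq]
    refine hcomp.deriv.trans ?_
    rw [hxz, mul_one, mul_comm]
  have hspace : Laplacian.laplacian (fun y => f y 1) x = sumSecondDeriv v z := by
    rw [laplacian_eq_sum_partialDeriv (hsol.contDiff_space 1 one_pos)]
    have htrans : ∀ (i : Fin (d + 1)) (h : EuclideanSpace ℝ (Fin (d + 1)) → ℝ),
        partialDeriv i (fun y => h (y + (η * 1) • e))
          = fun y => partialDeriv i h (y + (η * 1) • e) := by
      intro i h
      ext y
      simp only [partialDeriv, fderiv_comp_add_right]
    have hfun : (fun y => f y 1) = fun y => v (y + (η * 1) • e) := by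
      ext y
      rw [hwave y 1 zero_le_one, hsingle]
    simp_rw [hfun, htrans, hxz]
    rfl
  have h := hsol.equation x 1 one_pos
  rw [htime, hspace, hf1] at h
  linarith

theorem corollary4p3 (d : ℕ) (a b : ℝ) (ha : 0 < a) (hb : 0 < b) (η : ℝ)
    (f : EuclideanSpace ℝ (Fin (d + 1)) → ℝ → ℝ) (v : EuclideanSpace ℝ (Fin (d + 1)) → ℝ)
    (hpos : ∀ (x : EuclideanSpace ℝ (Fin (d + 1))) (t : ℝ), 0 ≤ t → 0 < f x t)
    (hsol : IsNewellWhiteheadSolution a b f)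
    (hwave : IsTravelingWave f v η) :
    ∀ z : EuclideanSpace ℝ (Fin (d + 1)),
      DifferentiableAt ℝ v z ∧ ‖gradient v z‖ ≤ |η| * v z := by
  intro z
  have hv := hsol.contDiff_profile hwave
  have hvpos : ∀ x, 0 < v x := fun x => by
    rw [hwave.profile_eq le_rfl]
    exact hpos _ 0 le_rfl
  have hvd := hv.differentiable (by norm_num)
  exact ⟨hvd z, norm_gradient_le_of_waveExcess_log_nonpos hvd hvpos
    (waveExcess_log_nonpos ha.le hb.le hv hvpos (hsol.profile_equation hwave) z)⟩
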